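/- Let $E$ be the Weierstrass curve $y^2+y=x^3+20$ over $\mathbb{Q}$ (the curve labeled 243a2 in Cremona's tables), and let $P=(-2,3)\in E(\mathbb{Q})$. Then $E$ is an elliptic curve, the given equation is a global minimal equation for it (it has integral coefficients and is a minimal Weierstrass equation over $\mathbb{Q}_q$ for every prime $q$), and the following hold: 1. for every prime $\ell\neq 3$ the point $3P$ is divisible by $9$ in $E(\mathbb{Q}_\ell)$, that is, there is a point $Q\in E(\mathbb{Q}_\ell)$ with $9Q=3P$; 2. the point $3P$ is not divisible by $9$ in $E(\mathbb{Q})$, that is, there is no point $Q\in E(\mathbb{Q})$ with $9Q=3P$. -/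

import Mathlib

noncomputable instance instDecidableEqPadicQ (p : ℕ) [Fact p.Prime] : DecidableEq ℚ_[p] :=
  Classical.decEq _

/-- The Weierstrass curve `y² + y = x³ + 20` over `ℚ` (Cremona label 243a2). -/
def E243a2 : WeierstrassCurve ℚ := ⟨0, 0, 1, 0, 20⟩

/-- The `K`-rational points `E(K)` of `y² + y = x³ + 20`, for a field extension `K` of `ℚ`;
Mathlib equips them with the chord-and-tangent group law. -/
abbrev E243a2.Points (K : Type*) [Field K] [Algebra ℚ K] : Type _ :=
  (E243a2.baseChange K).toAffine.Point

theorem E243a2.nonsingular_P :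
    (E243a2.baseChange ℚ).toAffine.Nonsingular (-2) 3 := by
  rw [WeierstrassCurve.Affine.nonsingular_iff, WeierstrassCurve.Affine.equation_iff]
  norm_num [E243a2, WeierstrassCurve.baseChange, WeierstrassCurve.map]

/-- The rational point `P = (-2, 3)`. -/
def E243a2.P : E243a2.Points ℚ := .some (-2) 3 E243a2.nonsingular_P

/-! ### The group law in coordinates. -/

namespace E243a2

/-! The point `T = (0, 4)` has order 3, so `9Q = 3P` holds as soon as `3Q` is `P` or `P + T`. Such
`Q` are given explicitly over three fields: `ℚ(∛3)`, `ℚ(ζ₉)` and `ℚ(∛(3ζ₃))`. For `ℓ ≠ 3` the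
cyclicity of the units mod `ℓ` makes 3, a primitive cube root of unity, or 3 times one, a cube mod
`ℓ`; Hensel's lemma lifts its cube root to `ℚ_ℓ` (`Padic.exists_cube_root_cases`).

Over `ℚ`, `9Q = 3P` puts `3Q - P` in `E(ℚ)[3] = {0, T, -T}`. Each of the equations `3Q = P`, `P +
T`, `P - T` fails already for `x`-coordinates modulo 5 or 7 (`three_nsmul_ne_of_zmod`).

Minimality holds because `Δ = -3 ^ 11` has every prime exponent below 12. -/

instance isElliptic : E243a2.IsElliptic := by
  rw [WeierstrassCurve.isElliptic_iff]
  norm_num [E243a2, WeierstrassCurve.Δ, WeierstrassCurve.b₂, WeierstrassCurve.b₄,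
    WeierstrassCurve.b₆, WeierstrassCurve.b₈]

variable {K : Type*} [Field K] [Algebra ℚ K]

instance : (E243a2.baseChange K).toAffine.IsElliptic :=
  inferInstanceAs (E243a2.map (algebraMap ℚ K)).IsElliptic

lemma nonsingular_iff {x y : K} :
    (E243a2.baseChange K).toAffine.Nonsingular x y ↔ y ^ 2 + y = x ^ 3 + 20 := by
  rw [← WeierstrassCurve.Affine.equation_iff_nonsingular, WeierstrassCurve.Affine.equation_iff]
  simp [E243a2, WeierstrassCurve.baseChange, WeierstrassCurve.map]

@[simp]
lemma negY_eq (x y : K) : (E243a2.baseChange K).toAffine.negY x y = -y - 1 := by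
  simp [WeierstrassCurve.Affine.negY, E243a2, WeierstrassCurve.baseChange, WeierstrassCurve.map]

@[simp]
lemma addX_eq (x₁ x₂ m : K) :
    (E243a2.baseChange K).toAffine.addX x₁ x₂ m = m ^ 2 - x₁ - x₂ := by
  simp [WeierstrassCurve.Affine.addX, E243a2, WeierstrassCurve.baseChange, WeierstrassCurve.map]

@[simp]
lemma addY_eq (x₁ x₂ y₁ m : K) :
    (E243a2.baseChange K).toAffine.addY x₁ x₂ y₁ m =
      -(m * (m ^ 2 - x₁ - x₂ - x₁) + y₁) - 1 := by
  rw [WeierstrassCurve.Affine.addY, negY_eq, WeierstrassCurve.Affine.negAddY, addX_eq]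

open WeierstrassCurve.Affine WeierstrassCurve.Affine.Point

/-- The point with given coordinates. -/
def point (x y : K) (h : y ^ 2 + y = x ^ 3 + 20) : E243a2.Points K :=
  .some x y (nonsingular_iff.2 h)

lemma neg_point {x y : K} (h : y ^ 2 + y = x ^ 3 + 20) :
    -point x y h = point x (-y - 1) (by linear_combination h) := by
  simp only [point, neg_some, negY_eq]

lemma exists_point {Q : E243a2.Points K} {x y : K}
    {h : (E243a2.baseChange K).toAffine.Nonsingular x y} (e : Q = .some x y h) :
    ∃ h', Q = point x y h' :=
  ⟨nonsingular_iff.1 h, e⟩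

variable [DecidableEq K]

lemma point_add_point {x₁ y₁ x₂ y₂ m : K} (h₁ : y₁ ^ 2 + y₁ = x₁ ^ 3 + 20)
    (h₂ : y₂ ^ 2 + y₂ = x₂ ^ 3 + 20) (hx : x₁ ≠ x₂) (hm : m * (x₁ - x₂) = y₁ - y₂) :
    ∃ h, point x₁ y₁ h₁ + point x₂ y₂ h₂ =
      point (m ^ 2 - x₁ - x₂) (-(m * (m ^ 2 - x₁ - x₂ - x₁) + y₁) - 1) h := by
  have hs : (E243a2.baseChange K).toAffine.slope x₁ x₂ y₁ y₂ = m := by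
    rw [slope_of_X_ne hx, div_eq_iff (sub_ne_zero.2 hx), hm]
  have := add_of_X_ne (h₁ := nonsingular_iff.2 h₁) (h₂ := nonsingular_iff.2 h₂) hx
  simp only [hs, addX_eq, addY_eq] at this
  exact exists_point this

lemma point_add_self {x y m : K} (h : y ^ 2 + y = x ^ 3 + 20) (hy : 2 * y + 1 ≠ 0)
    (hm : m * (2 * y + 1) = 3 * x ^ 2) :
    ∃ h', point x y h + point x y h =
      point (m ^ 2 - x - x) (-(m * (m ^ 2 - x - x - x) + y) - 1) h' := by
  have hy' : y ≠ (E243a2.baseChange K).toAffine.negY x y := by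
    rw [negY_eq]
    contrapose! hy
    linear_combination hy
  have hs : (E243a2.baseChange K).toAffine.slope x x y y = m := by
    rw [slope_of_Y_ne rfl hy', negY_eq, div_eq_iff]
    · simp only [E243a2, WeierstrassCurve.baseChange, WeierstrassCurve.map, _root_.map_zero]
      linear_combination -hm
    · contrapose! hy
      linear_combination hy
  have := add_self_of_Y_ne (h₁ := nonsingular_iff.2 h) hy'
  simp only [hs, addX_eq, addY_eq] at this
  exact exists_point this

/-- Tripling, with the inverses and slopes that occur given explicitly. -/
lemma three_nsmul_point {x y x₂ y₂ s t : K} (i m j n : K) (h : y ^ 2 + y = x ^ 3 + 20)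
    (hst : t ^ 2 + t = s ^ 3 + 20) (hi : (2 * y + 1) * i = 1) (hm : m * (2 * y + 1) = 3 * x ^ 2)
    (hx₂ : m ^ 2 - x - x = x₂) (hy₂ : -(m * (x₂ - x) + y) - 1 = y₂)
    (hj : (x₂ - x) * j = 1) (hn : n * (x₂ - x) = y₂ - y)
    (hs : n ^ 2 - x₂ - x = s) (ht : -(n * (s - x₂) + y₂) - 1 = t) :
    3 • point x y h = point s t hst := by
  subst hx₂ hy₂ hs ht
  obtain ⟨h₂, e₂⟩ := point_add_self h (left_ne_zero_of_mul_eq_one hi) hm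
  obtain ⟨h₃, e₃⟩ := point_add_point h₂ h
    (sub_ne_zero.1 (left_ne_zero_of_mul_eq_one hj)) hn
  rw [succ_nsmul, two_nsmul, e₂, e₃]

end E243a2

/-! ### Explicit solutions of `9Q = 3P` over three fields. -/

namespace E243a2

open WeierstrassCurve.Affine WeierstrassCurve.Affine.Point

section

variable {K : Type*} [Field K] [Algebra ℚ K] [DecidableEq K]

/-- The line `y = 4` meets the curve only at `x = 0`, triply: `T` is a flex. -/
lemma three_nsmul_torsion (h : (4 : K) ^ 2 + 4 = 0 ^ 3 + 20) : 3 • point 0 4 h = 0 := by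
  have : CharZero K := algebraRat.charZero K
  obtain ⟨h₂, e⟩ := point_add_self (m := 0) h (by norm_num) (by norm_num)
  have e₂ : point 0 4 h + point 0 4 h = -point 0 4 h := by
    rw [e, neg_point]
    simp [point]
  rw [succ_nsmul, two_nsmul, e₂, neg_add_cancel]

/-- The point `(9/4, -49/8)` is `P + T`. -/
lemma three_nsmul_translate (h₀ : (3 : K) ^ 2 + 3 = (-2) ^ 3 + 20)
    (h₁ : (-49 / 8 : K) ^ 2 + (-49 / 8) = (9 / 4) ^ 3 + 20) :
    3 • point (9 / 4) (-49 / 8) h₁ = 3 • point (-2) 3 h₀ := by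
  have : CharZero K := algebraRat.charZero K
  have hT : (4 : K) ^ 2 + 4 = 0 ^ 3 + 20 := by norm_num
  obtain ⟨h, e⟩ := point_add_point (m := 1 / 2) h₀ hT (by norm_num) (by norm_num)
  have e' : point (-2) 3 h₀ + point 0 4 hT = point (9 / 4) (-49 / 8) h₁ := by
    rw [e]
    simp only [point, Point.some.injEq]
    norm_num
  rw [← e', nsmul_add, three_nsmul_torsion, add_zero]

/-- A solution over `ℚ(∛3)`. -/
lemma exists_nine_nsmul_of_cbrt_three {z : K} (hz : z ^ 3 = 3)
    (h₀ : (3 : K) ^ 2 + 3 = (-2) ^ 3 + 20) :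
    ∃ Q : E243a2.Points K, 9 • Q = 3 • point (-2) 3 h₀ := by
  have : CharZero K := algebraRat.charZero K
  have h : (-41 - 27 * z - 18 * z ^ 2) ^ 2 + (-41 - 27 * z - 18 * z ^ 2) = (9 + 6 * z +
      3 * z ^ 2) ^ 3 + 20 := by
    linear_combination (-297 - 243 * z - 162 * z ^ 2 - 27 * z ^ 3) * hz
  have h₁ : (-49 / 8 : K) ^ 2 + (-49 / 8) = (9 / 4) ^ 3 + 20 := by norm_num
  refine ⟨point _ _ h, ?_⟩
  -- Here `3Q` is `P + T`; in the two other fields it is `P` itself.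
  have e := three_nsmul_point (x₂ := -9 + 6 * z + 3 * z ^ 2) (y₂ := -14 - 27 * z + 18 * z ^ 2)
    (-1 / 9 + 2 / 27 * z) (-3 - 3 * z)
    (-1 / 18) (-3 / 2 - 2 * z ^ 2) h h₁
    (by linear_combination (-8 / 3) * hz)
    (by linear_combination (-27 * z) * hz)
    (by ring)
    (by ring)
    (by ring)
    (by ring)
    (by linear_combination (4 * z) * hz)
    (by linear_combination (-12 - 6 * z) * hz)
  rw [show 9 = 3 * 3 from rfl, mul_nsmul, e, three_nsmul_translate h₀]

/-- A solution over `ℚ(ζ₉)`. -/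
lemma exists_nine_nsmul_of_zeta_nine {z : K} (hz : z ^ 6 + z ^ 3 + 1 = 0)
    (h₀ : (3 : K) ^ 2 + 3 = (-2) ^ 3 + 20) :
    ∃ Q : E243a2.Points K, 9 • Q = 3 • point (-2) 3 h₀ := by
  have : CharZero K := algebraRat.charZero K
  have h : (4 + 9 * z - 9 * z ^ 2 + 9 * z ^ 4) ^ 2 + (4 + 9 * z - 9 * z ^ 2 + 9 * z ^ 4) = (3 +
      3 * z ^ 4 + 3 * z ^ 5) ^ 3 + 20 := by
    linear_combination (-27 + 81 * z - 135 * z ^ 3 + 81 * z ^ 5 - 81 * z ^ 7 - 81 * z ^ 8 -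
        27 * z ^ 9) * hz
  refine ⟨point _ _ h, ?_⟩
  have e := three_nsmul_point (x₂ := 21 + 9 * z - 9 * z ^ 2 - 15 * z ^ 4 -
      24 * z ^ 5) (y₂ := -167 - 63 * z + 63 * z ^ 2 + 126 * z ^ 4 + 189 * z ^ 5)
    (1 / 9 + 2 / 27 * z - 2 / 27 * z ^ 2 - 2 / 27 * z ^ 4 - 4 / 27 * z ^ 5) (3 + 3 * z -
        3 * z ^ 2 - 3 * z ^ 5)
    (-1 / 9 + 1 / 27 * z - 1 / 27 * z ^ 2 - 1 / 27 * z ^ 4 - 2 / 27 * z ^ 5) (-2 + 3 * z ^ 4 +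
        3 * z ^ 5) h h₀
    (by linear_combination (8 / 3 * z - 4 / 3 * z ^ 2 - 8 / 3 * z ^ 3) * hz)
    (by linear_combination (81 * z - 27 * z ^ 2 - 108 * z ^ 3 - 27 * z ^ 4) * hz)
    (by linear_combination (-18 + 9 * z + 9 * z ^ 4) * hz)
    (by linear_combination (108 - 27 * z - 54 * z ^ 3 - 81 * z ^ 4) * hz)
    (by linear_combination (-3 - 1 / 3 * z + 2 / 3 * z ^ 2 + 7 / 3 * z ^ 3 + 2 * z ^ 4) * hz)
    (by linear_combination (135 + 54 * z - 54 * z ^ 2 - 135 * z ^ 3 - 81 * z ^ 4) * hz)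
    (by linear_combination (-18 - 9 * z + 9 * z ^ 2 + 18 * z ^ 3 + 9 * z ^ 4) * hz)
    (by linear_combination (117 + 45 * z - 45 * z ^ 2 - 117 * z ^ 3 - 72 * z ^ 4) * hz)
  rw [show 9 = 3 * 3 from rfl, mul_nsmul, e]

/-- A solution over `ℚ(∛(3ζ₃))`. -/
lemma exists_nine_nsmul_of_cbrt_three_mul_zeta_three {z : K} (hz : z ^ 6 + 3 * z ^ 3 + 9 = 0)
    (h₀ : (3 : K) ^ 2 + 3 = (-2) ^ 3 + 20) :
    ∃ Q : E243a2.Points K, 9 • Q = 3 • point (-2) 3 h₀ := by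
  have : CharZero K := algebraRat.charZero K
  have h : (4 + 18 * z - 6 * z ^ 3 + 3 * z ^ 4 + 3 * z ^ 5) ^ 2 + (4 + 18 * z - 6 * z ^ 3 +
      3 * z ^ 4 + 3 * z ^ 5) = (-6 + 3 * z ^ 2 - z ^ 3 - z ^ 4) ^ 3 + 20 := by
    linear_combination (24 + 18 * z - 2 * z ^ 3 + 3 * z ^ 4 + 3 * z ^ 5 + z ^ 6) * hz
  refine ⟨point _ _ h, ?_⟩
  have e := three_nsmul_point (x₂ := -60 / 49 - 117 / 49 * z - 15 / 49 * z ^ 2 -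
      37 / 49 * z ^ 3 - 55 / 49 * z ^ 4 + 3 / 49 * z ^ 5) (y₂ := -2201 / 343 - 639 / 343 * z -
      783 / 343 * z ^ 2 - 1020 / 343 * z ^ 3 + 69 / 343 * z ^ 4 + 186 / 343 * z ^ 5)
    (5 / 189 + 8 / 189 * z - 4 / 189 * z ^ 2 + 4 / 567 * z ^ 3 - 2 / 567 * z ^ 4 -
        2 / 189 * z ^ 5) (3 / 7 - 12 / 7 * z - 1 / 7 * z ^ 2 + 5 / 7 * z ^ 3 + 1 / 7 * z ^ 4 -
        5 / 21 * z ^ 5)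
    (1 / 27 + 1 / 27 * z + 1 / 27 * z ^ 2 - 1 / 81 * z ^ 3 + 2 / 81 * z ^ 4) (4 / 7 -
        9 / 7 * z - 6 / 7 * z ^ 2 + 2 / 7 * z ^ 3 - 1 / 7 * z ^ 4 - 3 / 7 * z ^ 5) h h₀
    (by linear_combination (-16 / 189 + 4 / 27 * z + 4 / 27 * z ^ 2 - 16 / 189 * z ^ 3 -
        4 / 63 * z ^ 4) * hz)
    (by linear_combination (-81 / 7 + 5 * z ^ 2 - 4 / 7 * z ^ 3 - 10 / 7 * z ^ 4) * hz)
    (by linear_combination (73 / 49 + 5 / 49 * z - 47 / 147 * z ^ 2 - 10 / 147 * z ^ 3 +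
        25 / 441 * z ^ 4) * hz)
    (by linear_combination (-24 / 343 - 264 / 343 * z + 11 / 343 * z ^ 2 - 13 / 343 * z ^ 3 +
        5 / 343 * z ^ 4) * hz)
    (by linear_combination (-121 / 1323 + 13 / 1323 * z - 5 / 1323 * z ^ 2 + 2 / 1323 * z ^ 3) * hz)
    (by linear_combination (501 / 343 + 471 / 343 * z - 24 / 343 * z ^ 2 + 15 / 343 * z ^ 3 -
        9 / 343 * z ^ 4) * hz)
    (by linear_combination (52 / 49 + 5 / 49 * z - 11 / 49 * z ^ 2 + 6 / 49 * z ^ 3 +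
        9 / 49 * z ^ 4) * hz)
    (by linear_combination (109 / 343 - 19 / 343 * z + 172 / 343 * z ^ 2 + 162 / 343 * z ^ 3 -
        9 / 343 * z ^ 4) * hz)
  rw [show 9 = 3 * 3 from rfl, mul_nsmul, e]

end

end E243a2

/-! ### Cube roots modulo `p` and in `ℚ_p`. -/

section

open Polynomial

lemma Padic.exists_aeval_eq_zero_of_zmod {p : ℕ} [Fact p.Prime] (F : ℤ[X]) (a : ZMod p)
    (h : aeval a F = 0) (h' : aeval a (derivative F) ≠ 0) : ∃ z : ℚ_[p], aeval z F = 0 := by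
  obtain ⟨b, rfl⟩ := ZMod.ringHom_surjective (PadicInt.toZMod (p := p)) a
  have key (G : ℤ[X]) : aeval (PadicInt.toZMod b) G = PadicInt.toZMod (aeval b G) := by
    simp only [aeval_def, hom_eval₂]
    congr 1
    exact RingHom.ext_int _ _
  have hlt (c : ℤ_[p]) : ‖c‖ < 1 ↔ PadicInt.toZMod c = 0 := by
    rw [← RingHom.mem_ker, PadicInt.ker_toZMod, IsLocalRing.mem_maximalIdeal,
      PadicInt.mem_nonunits]
  rw [key] at h h'
  have h1 : ‖aeval b (derivative F)‖ = 1 :=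
    le_antisymm (PadicInt.norm_le_one _) (not_lt.1 fun H => h' ((hlt _).1 H))
  obtain ⟨z, hz, -⟩ := hensels_lemma (F := F) (a := b) (by rw [h1, one_pow]; exact (hlt _).2 h)
  refine ⟨z, ?_⟩
  have := aeval_algebraMap_apply ℚ_[p] z F
  rw [hz, map_zero] at this
  exact this

lemma ZMod.exists_cube_root_cases {p : ℕ} [Fact p.Prime] (hp : p ≠ 3) :
    ∃ z : ZMod p, z ^ 3 = 3 ∨ z ^ 6 + z ^ 3 + 1 = 0 ∨ z ^ 6 + 3 * z ^ 3 + 9 = 0 := by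
  have hP : p.Prime := Fact.out
  have h3 : (3 : ZMod p) ≠ 0 := by
    intro h
    have : p ∣ 3 := (ZMod.natCast_eq_zero_iff 3 p).1 (by exact_mod_cast h)
    exact hp ((Nat.prime_dvd_prime_iff_eq hP Nat.prime_three).1 this)
  have hmod : p % 3 = 1 ∨ p % 3 = 2 := by
    have : ¬ 3 ∣ p := fun h => hp ((Nat.prime_dvd_prime_iff_eq Nat.prime_three hP).1 h).symm
    lia
  rcases hmod with hmod | hmod
  · obtain ⟨k, hk⟩ : ∃ k, p = 3 * k + 1 := ⟨p / 3, by lia⟩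
    have hk0 : 0 < k := by have := hP.two_le; lia
    obtain ⟨g, hg⟩ := IsCyclic.exists_monoid_generator (α := (ZMod p)ˣ)
    have hord : orderOf g = 3 * k := by
      rw [orderOf_eq_card_of_forall_mem_powers hg, Nat.card_eq_fintype_card,
        ZMod.card_units_eq_totient, Nat.totient_prime hP, hk, Nat.add_sub_cancel]
    obtain ⟨i, hi⟩ := hg (Units.mk0 3 h3)
    have hi' : (g : ZMod p) ^ i = 3 := by
      simpa using congrArg Units.val hi
    have hω : (g : ZMod p) ^ k ≠ 1 := by
      intro h
      have : g ^ k = 1 := Units.ext (by simpa using h)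
      have := Nat.le_of_dvd hk0 (orderOf_dvd_of_pow_eq_one this)
      lia
    have hω3 : ((g : ZMod p) ^ k) ^ 3 = 1 := by
      rw [← pow_mul, mul_comm, ← hord, ← Units.val_pow_eq_pow_val, pow_orderOf_eq_one,
        Units.val_one]
    have hω1 : ((g : ZMod p) ^ k) ^ 2 + (g : ZMod p) ^ k + 1 = 0 := by
      apply mul_left_cancel₀ (sub_ne_zero.2 hω)
      linear_combination hω3
    have aux (m : ℕ) (e : ZMod p) (h : (g : ZMod p) ^ (3 * m) = e) :
        ((g : ZMod p) ^ m) ^ 3 = e := by rw [← pow_mul, mul_comm, h]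
    -- With `ω = g ^ k` and `3 = g ^ i`, these say that `3`, `ω`, `3ω` or `3ω²` is a cube.
    have hcases : 3 ∣ i ∨ 3 ∣ k ∨ 3 ∣ i + k ∨ 3 ∣ i + 2 * k := by lia
    rcases hcases with ⟨m, hm⟩ | ⟨m, hm⟩ | ⟨m, hm⟩ | ⟨m, hm⟩
    · exact ⟨_, .inl (aux m 3 (hm ▸ hi'))⟩
    · have := aux m _ (congrArg _ hm.symm)
      refine ⟨g ^ m, .inr (.inl ?_)⟩
      linear_combination hω1 + (((g : ZMod p) ^ m) ^ 3 + (g : ZMod p) ^ k + 1) * this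
    · have := aux m (3 * (g : ZMod p) ^ k) (by rw [← hm, pow_add, hi'])
      refine ⟨g ^ m, .inr (.inr ?_)⟩
      linear_combination 9 * hω1 + (((g : ZMod p) ^ m) ^ 3 + 3 * (g : ZMod p) ^ k + 3) * this
    · have := aux m (3 * ((g : ZMod p) ^ k) ^ 2) (by rw [← hm, pow_add, hi', ← pow_mul, mul_comm 2])
      refine ⟨g ^ m, .inr (.inr ?_)⟩
      linear_combination 9 * hω1 + (((g : ZMod p) ^ m) ^ 3 + 3 * ((g : ZMod p) ^ k) ^ 2 + 3) * this
        + 9 * (g : ZMod p) ^ k * hω3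
  · obtain ⟨k, hk⟩ : ∃ k, p = 3 * k + 2 := ⟨p / 3, by lia⟩
    have h := ZMod.pow_card_sub_one_eq_one h3
    rw [show p - 1 = 3 * k + 1 by lia] at h
    -- Cubing is bijective here: `2k + 1` inverts 3 modulo `p - 1 = 3k + 1`.
    refine ⟨3 ^ (2 * k + 1), .inl ?_⟩
    calc ((3 : ZMod p) ^ (2 * k + 1)) ^ 3 = (3 ^ (3 * k + 1)) ^ 2 * 3 := by ring
      _ = 3 := by rw [h]; ring

lemma Padic.exists_cube_root_cases {p : ℕ} [Fact p.Prime] (hp : p ≠ 3) :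
    ∃ z : ℚ_[p], z ^ 3 = 3 ∨ z ^ 6 + z ^ 3 + 1 = 0 ∨ z ^ 6 + 3 * z ^ 3 + 9 = 0 := by
  have h3 : (3 : ZMod p) ≠ 0 := by
    intro h
    have : p ∣ 3 := (ZMod.natCast_eq_zero_iff 3 p).1 (by exact_mod_cast h)
    exact hp ((Nat.prime_dvd_prime_iff_eq Fact.out Nat.prime_three).1 this)
  obtain ⟨z, hz | hz | hz⟩ := ZMod.exists_cube_root_cases hp
  · have hz0 : z ≠ 0 := by rintro rfl; exact h3 (by linear_combination -hz)
    obtain ⟨w, hw⟩ := exists_aeval_eq_zero_of_zmod (X ^ 3 - 3) z (by simp [hz, map_ofNat])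
      (by simp [h3, hz0, map_ofNat])
    exact ⟨w, .inl (by simpa [sub_eq_zero, map_ofNat] using hw)⟩
  · have hz0 : z ≠ 0 := by rintro rfl; exact one_ne_zero (α := ZMod p) (by linear_combination hz)
    -- The quadratic in `z ^ 3` has discriminant -3, a unit mod `p`, so the root is simple.
    have hd : 2 * z ^ 3 + 1 ≠ 0 := fun h =>
      h3 (by linear_combination 4 * hz - (2 * z ^ 3 + 1) * h)
    obtain ⟨w, hw⟩ := exists_aeval_eq_zero_of_zmod (X ^ 6 + X ^ 3 + 1) z (by simp [hz]) (by
      rw [show aeval z (derivative (X ^ 6 + X ^ 3 + 1 : ℤ[X])) = 3 * z ^ 2 * (2 * z ^ 3 + 1) by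
        simp [map_ofNat]; ring]
      exact mul_ne_zero (mul_ne_zero h3 (pow_ne_zero _ hz0)) hd)
    exact ⟨w, .inr (.inl (by simpa using hw))⟩
  · have hz0 : z ≠ 0 := by
      rintro rfl
      exact pow_ne_zero 2 h3 (by linear_combination hz)
    have hd : 2 * z ^ 3 + 3 ≠ 0 := fun h =>
      pow_ne_zero 3 h3 (by linear_combination 4 * hz - (2 * z ^ 3 + 3) * h)
    obtain ⟨w, hw⟩ := exists_aeval_eq_zero_of_zmod (X ^ 6 + 3 * X ^ 3 +
        9) z (by simp [hz, map_ofNat]) (by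
      rw [show aeval z (derivative (X ^ 6 + 3 * X ^ 3 + 9 : ℤ[X])) =
          3 * z ^ 2 * (2 * z ^ 3 + 3) by simp [map_ofNat]; ring]
      exact mul_ne_zero (mul_ne_zero h3 (pow_ne_zero _ hz0)) hd)
    exact ⟨w, .inr (.inr (by simpa [map_ofNat] using hw))⟩

end

/-! ### Minimality from the discriminant. -/

namespace WeierstrassCurve

open WithZero IsDiscreteValuationRing IsDedekindDomain.HeightOneSpectrum

/-- A change of variables scales `Δ` by `u⁻¹ ^ 12`. Enlarging its absolute value would gain at least
`exp 12`, making the new discriminant non-integral. -/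
lemma isMinimal_of_exp_neg_twelve_lt {R K : Type*} [CommRing R] [IsDomain R]
    [IsDiscreteValuationRing R] [Field K] [Algebra R K] [IsFractionRing R K]
    (W : WeierstrassCurve K) [IsIntegral R W]
    (hW : exp (-12) < valuation K (maximalIdeal R) W.Δ) : IsMinimal R W := by
  refine ⟨⟨by simpa only [one_smul], fun C hC _ => ?_⟩⟩
  have : IsIntegral R (C • W) := hC
  have : IsIntegral R ((1 : VariableChange K) • W) := by rw [one_smul]; infer_instance
  have hle := (valuation_Δ_aux R (C • W)).2
  rw [← Subtype.coe_le_coe, valuation_Δ_aux_eq_of_isIntegral, valuation_Δ_aux_eq_of_isIntegral,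
    one_smul]
  rw [valuation_Δ_aux_eq_of_isIntegral] at hle
  rw [variableChange_Δ, map_mul, map_pow] at hle ⊢
  set w := valuation K (maximalIdeal R) (C.u⁻¹ : Kˣ)
  rcases le_or_gt w 1 with h | h
  · exact mul_le_of_le_one_left' (pow_le_one' h 12)
  · exfalso
    have h1 : exp (1 : ℤ) ≤ w := by
      have hw : w ≠ 0 := (zero_lt_one.trans h).ne'
      rw [← exp_log hw] at h ⊢
      rw [← exp_zero, exp_lt_exp] at h
      exact exp_le_exp.2 h
    have h2 : (1 : ℤᵐ⁰) = exp (1 : ℤ) ^ 12 * exp (-12) := by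
      rw [← exp_nsmul, ← exp_add]
      rfl
    refine (h2 ▸ hle).not_gt ?_
    exact mul_lt_mul_of_le_of_lt_of_nonneg_of_pos (pow_le_pow_left' h1 12) hW zero_le
      (pow_pos (zero_lt_one.trans h) 12)

end WeierstrassCurve

namespace E243a2

lemma Δ_eq : E243a2.Δ = -3 ^ 11 := by
  norm_num [E243a2, WeierstrassCurve.Δ, WeierstrassCurve.b₂, WeierstrassCurve.b₄,
    WeierstrassCurve.b₆, WeierstrassCurve.b₈]

open WithZero IsDiscreteValuationRing IsDedekindDomain.HeightOneSpectrum

lemma exp_neg_one_le_valuation_three (q : ℕ) [Fact q.Prime] :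
    exp (-1) ≤ valuation ℚ_[q] (maximalIdeal ℤ_[q]) 3 := by
  rw [show (3 : ℚ_[q]) = algebraMap ℤ_[q] ℚ_[q] 3 from (map_ofNat _ 3).symm,
    valuation_of_algebraMap]
  by_cases h : q = 3
  · subst h
    refine (intValuation_singleton _ (r := 3) (by norm_num) ?_).ge
    exact PadicInt.maximalIdeal_eq_span_p
  · rw [intValuation_eq_one_iff.2]
    · rw [← exp_zero, exp_le_exp]
      norm_num
    · intro h3
      have h3 : (3 : ℤ_[q]) ∈ IsLocalRing.maximalIdeal ℤ_[q] := h3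
      rw [IsLocalRing.mem_maximalIdeal, PadicInt.mem_nonunits] at h3
      have : q ∣ 3 := by
        have := (PadicInt.norm_int_lt_one_iff_dvd (p := q) 3).1 (by exact_mod_cast h3)
        exact_mod_cast this
      exact h ((Nat.prime_dvd_prime_iff_eq Fact.out Nat.prime_three).1 this)

lemma isMinimal (q : ℕ) [Fact q.Prime] :
    WeierstrassCurve.IsMinimal ℤ_[q] (E243a2.baseChange ℚ_[q]) := by
  have : WeierstrassCurve.IsIntegral ℤ_[q] (E243a2.baseChange ℚ_[q]) :=
    ⟨⟨0, 0, 1, 0, 20⟩, by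
      ext <;> simp [E243a2, WeierstrassCurve.baseChange, WeierstrassCurve.map, map_ofNat]⟩
  apply WeierstrassCurve.isMinimal_of_exp_neg_twelve_lt
  rw [WeierstrassCurve.baseChange, WeierstrassCurve.map_Δ, Δ_eq, map_neg, Valuation.map_neg,
    map_pow, map_pow, map_ofNat]
  refine lt_of_lt_of_le ?_ (pow_le_pow_left' (exp_neg_one_le_valuation_three q) 11)
  rw [← exp_nsmul, exp_lt_exp]
  norm_num

end E243a2

/-! ### Non-divisibility over `ℚ`. -/

namespace E243a2

open WeierstrassCurve.Affine WeierstrassCurve.Affine.Point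

section

variable {K : Type*} [Field K] [Algebra ℚ K]

lemma eq_zero_or_exists_point (Q : E243a2.Points K) : Q = 0 ∨ ∃ x y h, Q = point x y h := by
  rcases Q with _ | ⟨x, y, h⟩
  · exact .inl rfl
  · exact .inr ⟨x, y, nonsingular_iff.1 h, rfl⟩

lemma point_ne_zero {x y : K} (h : y ^ 2 + y = x ^ 3 + 20) : point x y h ≠ 0 :=
  some_ne_zero _

lemma point_inj {x₁ y₁ x₂ y₂ : K} {h₁ : y₁ ^ 2 + y₁ = x₁ ^ 3 + 20} {h₂ : y₂ ^ 2 + y₂ = x₂ ^ 3 +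
    20} :
    point x₁ y₁ h₁ = point x₂ y₂ h₂ ↔ x₁ = x₂ ∧ y₁ = y₂ := by
  simp only [point, Point.some.injEq]

lemma point_eq_neg_self {x y : K} (h : y ^ 2 + y = x ^ 3 + 20) (hy : 2 * y + 1 = 0) :
    point x y h = -point x y h := by
  rw [neg_point, point_inj]
  exact ⟨rfl, by linear_combination hy⟩

variable [DecidableEq K]

lemma three_torsion_polynomial {x y : K} {h : y ^ 2 + y = x ^ 3 + 20}
    (e : 3 • point x y h = 0) : 3 * (x * (x ^ 3 + 81)) = 0 := by
  rw [succ_nsmul, two_nsmul, add_eq_zero_iff_eq_neg] at e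
  by_cases hy : 2 * y + 1 = 0
  · rw [← point_eq_neg_self h hy, add_eq_right] at e
    exact absurd e (point_ne_zero h)
  · obtain ⟨m, hm⟩ : ∃ m, m * (2 * y + 1) = 3 * x ^ 2 := ⟨_, div_mul_cancel₀ _ hy⟩
    obtain ⟨h₂, e₂⟩ := point_add_self h hy hm
    rw [e₂, neg_point, point_inj] at e
    -- `e.1` says that doubling fixes the `x`-coordinate; multiplying by `(2y + 1)²` clears the
    -- slope.
    linear_combination (m * (2 * y + 1) + 3 * x ^ 2) * hm - (2 * y + 1) ^ 2 * e.1 - 12 * x * h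

lemma three_nsmul_polynomial {x y s t : K} {h : y ^ 2 + y = x ^ 3 + 20}
    {hst : t ^ 2 + t = s ^ 3 + 20} (e : 3 • point x y h = point s t hst) :
    x ^ 9 - 1944 * x ^ 6 + 19683 * x ^ 3 + 531441 = 9 * s * (x ^ 2 * (x ^ 3 + 81) ^ 2) := by
  rw [succ_nsmul, two_nsmul] at e
  by_cases hy : 2 * y + 1 = 0
  · nth_rewrite 1 [point_eq_neg_self h hy] at e
    rw [neg_add_cancel, zero_add, point_inj] at e
    obtain ⟨rfl, -⟩ := e
    have h4 : 4 * x ^ 3 + 81 = 0 := by linear_combination (2 * y + 1) * hy - 4 * h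
    linear_combination (-2 * x ^ 6 - 810 * x ^ 3 + 6561) * h4
  · obtain ⟨m, hm⟩ : ∃ m, m * (2 * y + 1) = 3 * x ^ 2 := ⟨_, div_mul_cancel₀ _ hy⟩
    obtain ⟨h₂, e₂⟩ := point_add_self h hy hm
    rw [e₂] at e
    by_cases hx : m ^ 2 - x - x = x
    · refine absurd e.symm ?_
      rw [add_eq_zero_iff_eq_neg.2]
      · exact point_ne_zero hst
      · rw [neg_point, point_inj]
        exact ⟨hx, by linear_combination -m * hx⟩
    · obtain ⟨n, hn⟩ : ∃ n, n * (m ^ 2 - x - x - x) = -(m * (m ^ 2 - x - x - x) + y) - 1 - y :=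
        ⟨_, div_mul_cancel₀ _ (sub_ne_zero.2 hx)⟩
      obtain ⟨h₃, e₃⟩ := point_add_point h₂ h hx hn
      rw [e₃, point_inj] at e
      obtain ⟨hs, -⟩ := e
      -- Both `Y²` and `D * Y²` are polynomials in `x`, so scaling by `D² * Y⁴` eliminates `y` and
      -- the slopes.
      obtain ⟨D, hD⟩ : ∃ D, D = m ^ 2 - x - x - x := ⟨_, rfl⟩
      obtain ⟨Y, hY⟩ : ∃ Y, Y = 2 * y + 1 := ⟨_, rfl⟩
      rw [← hD] at hn
      rw [← hY] at hm
      have hY2 : Y ^ 2 = 4 * x ^ 3 + 81 := by rw [hY]; linear_combination 4 * h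
      have hDY : D * Y ^ 2 = -3 * (x * (x ^ 3 + 81)) := by
        rw [hD]
        linear_combination (m * Y + 3 * x ^ 2) * hm - 3 * x * hY2
      have hn' : n * D = -(m * D) - Y := by rw [hn, hY]; ring
      have hsD : s * D ^ 2 * Y ^ 4 = (6 * x ^ 2 * D + Y ^ 2 + x * D ^ 2) * Y ^ 4 := by
        rw [← hs]
        linear_combination Y ^ 4 * (n * D - m * D - Y) * hn' + 2 * D * Y ^ 4 * hm
      have h1 : s * (D * Y ^ 2) ^ 2 =
          6 * x ^ 2 * (D * Y ^ 2) * Y ^ 2 + (Y ^ 2) ^ 3 + x * (D * Y ^ 2) ^ 2 := by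
        linear_combination hsD
      rw [hDY, hY2] at h1
      linear_combination -h1

end

instance fact_prime_five : Fact (Nat.Prime 5) := ⟨by norm_num⟩

instance fact_prime_seven : Fact (Nat.Prime 7) := ⟨by norm_num⟩

lemma _root_.Rat.exists_eq_div_zmod (p : ℕ) [Fact p.Prime] (x : ℚ) :
    ∃ n d : ℤ, x * d = n ∧ ¬ ((n : ZMod p) = 0 ∧ (d : ZMod p) = 0) := by
  refine ⟨x.num, x.den, by simp, fun ⟨hn, hd⟩ => ?_⟩
  rw [ZMod.intCast_zmod_eq_zero_iff_dvd] at hn hd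
  have h1 : p ∣ Nat.gcd x.num.natAbs x.den :=
    Nat.dvd_gcd (Int.natCast_dvd.1 hn) (Int.natCast_dvd_natCast.1 hd)
  rw [x.reduced.gcd_eq_one] at h1
  exact (Fact.out : p.Prime).one_lt.ne' (Nat.dvd_one.1 h1)

/-- Cubes mod 7 are 0 and ±1, whereas `-81` is 3. -/
lemma cube_add_ne_zero (x : ℚ) : x ^ 3 + 81 ≠ 0 := by
  intro h
  obtain ⟨n, d, hx, hnd⟩ := Rat.exists_eq_div_zmod 7 x
  have hz : n ^ 3 + 81 * d ^ 3 = 0 := by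
    have : (n : ℚ) ^ 3 + 81 * d ^ 3 = 0 := by rw [← hx]; linear_combination (d : ℚ) ^ 3 * h
    exact_mod_cast this
  have hz' : (n : ZMod 7) ^ 3 + 81 * (d : ZMod 7) ^ 3 = 0 := by
    exact_mod_cast congrArg (Int.cast : ℤ → ZMod 7) hz
  generalize (n : ZMod 7) = a at *
  generalize (d : ZMod 7) = b at *
  revert a b
  decide

/-- The homogenized equation for the `x`-coordinates of the points `Q` such that `3 • Q` has
`x`-coordinate `u / v`. -/
def triplingForm {R : Type*} [CommRing R] (u v n d : R) : R :=
  v * (n ^ 9 - 1944 * n ^ 6 * d ^ 3 + 19683 * n ^ 3 * d ^ 6 + 531441 * d ^ 9) -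
    9 * u * (n ^ 2 * d * (n ^ 3 + 81 * d ^ 3) ^ 2)

/-- A rational `x` in lowest terms reduces to a point of the projective line over `ZMod p`, where
`H` leaves the form no zero. -/
lemma three_nsmul_ne_of_zmod (p : ℕ) [Fact p.Prime] (u v : ℤ)
    (H : ∀ a b : ZMod p, triplingForm (u : ZMod p) v a b = 0 → a = 0 ∧ b = 0)
    {s t : ℚ} (hs : s * v = u) (hst : t ^ 2 + t = s ^ 3 + 20) (Q : E243a2.Points ℚ) :
    3 • Q ≠ point s t hst := by
  intro e
  obtain rfl | ⟨x, y, h, rfl⟩ := eq_zero_or_exists_point Q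
  · exact point_ne_zero hst (by rw [← e, nsmul_zero])
  have hx := three_nsmul_polynomial e
  obtain ⟨n, d, hxd, hnd⟩ := Rat.exists_eq_div_zmod p x
  have hz : triplingForm u v n d = 0 := by
    have : triplingForm (u : ℚ) v n d = 0 := by
      rw [← hxd, ← hs, triplingForm]
      linear_combination (v : ℚ) * (d : ℚ) ^ 9 * hx
    unfold triplingForm at this ⊢
    exact_mod_cast this
  refine hnd (H n d ?_)
  have := congrArg (Int.cast : ℤ → ZMod p) hz
  unfold triplingForm at this ⊢
  exact_mod_cast this

lemma not_exists_nine_nsmul : ¬ ∃ Q : E243a2.Points ℚ, 9 • Q = 3 • E243a2.P := by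
  rintro ⟨Q, hQ⟩
  have hP : (3 : ℚ) ^ 2 + 3 = (-2) ^ 3 + 20 := by norm_num
  have hPp : E243a2.P = point (-2) 3 hP := rfl
  rw [hPp] at hQ
  have hR : 3 • (3 • Q - point (-2) 3 hP) = 0 := by
    rw [nsmul_sub, ← mul_nsmul, hQ, sub_self]
  obtain h0 | ⟨x, y, h, hxy⟩ := eq_zero_or_exists_point (3 • Q - point (-2) 3 hP)
  -- The three targets `P`, `P + T`, `P - T` have `x`-coordinates -2, 9/4 and 18.
  · exact three_nsmul_ne_of_zmod 5 (-2) 1 (by unfold triplingForm; decide) (by norm_num) hP Q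
      (sub_eq_zero.1 h0)
  · have hx := three_torsion_polynomial (hxy ▸ hR)
    obtain rfl : x = 0 := by simpa [cube_add_ne_zero] using hx
    rw [sub_eq_iff_eq_add'] at hxy
    have hy : (y - 4) * (y + 5) = 0 := by linear_combination h
    rcases mul_eq_zero.1 hy with hy | hy
    · obtain rfl : y = 4 := by linear_combination hy
      obtain ⟨h', e⟩ := point_add_point (m := 1 / 2) hP h (by norm_num) (by norm_num)
      exact three_nsmul_ne_of_zmod 7 9 4 (by unfold triplingForm; decide) (by norm_num) h' Q
        (hxy.trans e)
    · obtain rfl : y = -5 := by linear_combination hy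
      obtain ⟨h', e⟩ := point_add_point (m := -4) hP h (by norm_num) (by norm_num)
      exact three_nsmul_ne_of_zmod 5 18 1 (by unfold triplingForm; decide) (by norm_num) h' Q
        (hxy.trans e)

end E243a2

namespace E243a2

lemma exists_nine_nsmul_padic (l : ℕ) [Fact l.Prime] (hl : l ≠ 3) :
    ∃ Q : E243a2.Points ℚ_[l],
      9 • Q = WeierstrassCurve.Affine.Point.baseChange ℚ ℚ_[l] (3 • E243a2.P) := by
  have h₀ : (3 : ℚ_[l]) ^ 2 + 3 = (-2) ^ 3 + 20 := by norm_num
  have hP : WeierstrassCurve.Affine.Point.baseChange ℚ ℚ_[l] E243a2.P = point (-2) 3 h₀ := by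
    rw [E243a2.P, WeierstrassCurve.Affine.Point.map_some]
    simp [point, map_ofNat]
  rw [map_nsmul, hP]
  obtain ⟨z, hz | hz | hz⟩ := Padic.exists_cube_root_cases hl
  · exact exists_nine_nsmul_of_cbrt_three hz h₀
  · exact exists_nine_nsmul_of_zeta_nine hz h₀
  · exact exists_nine_nsmul_of_cbrt_three_mul_zeta_three hz h₀

end E243a2

theorem mainTheorem8 :
    E243a2.IsElliptic ∧
    (∀ (q : ℕ) [Fact q.Prime],
      WeierstrassCurve.IsMinimal ℤ_[q] (E243a2.baseChange ℚ_[q])) ∧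
    (∀ (l : ℕ) [Fact l.Prime], l ≠ 3 →
      ∃ Q : E243a2.Points ℚ_[l],
        9 • Q = WeierstrassCurve.Affine.Point.baseChange ℚ ℚ_[l] (3 • E243a2.P)) ∧
    ¬ ∃ Q : E243a2.Points ℚ, 9 • Q = 3 • E243a2.P :=
  ⟨E243a2.isElliptic, fun q _ => E243a2.isMinimal q,
    fun l _ hl => E243a2.exists_nine_nsmul_padic l hl, E243a2.not_exists_nine_nsmul⟩
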